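/- Let $n\ge 1$. The one-sided transposition shuffle $P_n$ is the random walk on $S_n$ generated by the probability distribution that gives mass $\frac1n\cdot\frac1j$ to the transposition $(i\,j)$ for each pair $1\le i\le j\le n$, where $(i\,i)$ means the identity (so $P_n(\mathrm{id})=\frac1n\sum_{j=1}^n\frac1j$). We also regard $P_n$ as the element $\sum_{1\le i\le j\le n}\frac{1}{nj}(i\,j)$ of the group algebra $\mathbb C[S_n]$. Let $M^n$ be the complex vector space with basis the words $w=w_1\cdots w_n$ of length $n$ in positive integers. It is a $\mathbb C[S_n]$-module by place permutations, $\sigma(w)=w_{\sigma^{-1}(1)}\cdots w_{\sigma^{-1}(n)}$. Boxes of Young diagrams have coordinates $(i,j)$ ($i$ = row, $j$ = column, both counted from $1$). For a standard Young tableau $T$ of size $n$ let $w(T)$ be the word whose $p$-th symbol is the row of $T$ that contains $p$, and let $s(T)=\sum_\sigma \mathrm{sign}(\sigma)\,w(\sigma(T))$, summed over the column stabilizer of $T$. The Specht module $S^\lambda\subset M^n$ of a partition $\lambda\vdash n$ is the submodule generated by the vectors $s(T)$, $T$ a standard Young tableau of shape $\lambda$. For $a\ge1$ let $\Phi_a:M^m\to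 M^{m+1}$ be the linear map $w\mapsto w\cdot a$ that appends the symbol $a$, and for $\mu\vdash m+1$ let $\pi^\mu:M^{m+1}\to M^{m+1}$ be the $\mathbb C[S_{m+1}]$-linear projection onto the $S^\mu$-isotypic component. For a standard Young tableau $T$ of shape $\lambda\vdash n$ let $\lambda^{(m)}$ be the shape formed by the boxes of $T$ with entries $1,\dots,m$, and let $a_m$ be the row of $T$ that contains $m$. Define $v_T\in M^n$ by adding the boxes in the order of their labels and lifting: $v_0$ is the empty word, $v_m=\pi^{\lambda^{(m)}}\bigl(\Phi_{a_m}(v_{m-1})\bigr)$ for $1\le m\le n$, and $v_T=v_n$. The eigenvalue corresponding to $T$, denoted $\mathrm{eig}(T)$, is the eigenvalue of $P_n$ on the vector $v_T$. **Lemma.** Let $n\ge1$ and let $T$ be a standard Young tableau of shape $\lambda\vdash n$. Then $v_T\in S^\lambda$, $v_T$ is an eigenvector of $P_n$ (in particular $v_T\ne0$), and its eigenvalue, the eigenvalue corresponding to $T$, is $$\mathrm{eig}(T)=\frac1n\sum_{(i,j)}\frac{j-i+1}{T(i,j)},$$ where the sum is over all boxes $(i,j)$ of $T$ and $T(i,j)$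 is the entry of $T$ in the box $(i,j)$. This number is an eigenvalue of the transition matrix $\bigl(P_n(\sigma'\sigma^{-1})\bigr)_{\sigma,\sigma'\in S_n}$ of the shuffle. -/

import Mathlib

open scoped BigOperators

noncomputable section

namespace OneSided

/-! ### The shuffle

Positions in a deck of `n` cards are the elements of `Fin n`; the position written `p` in
`1, …, n` is `p - 1 : Fin n`. -/

/-- The symmetric group on the `n` positions. -/
abbrev Sym (n : ℕ) : Type := Equiv.Perm (Fin n)

/-- The distribution of one step of the one-sided transposition shuffle: each pair of positions
`i ≤ j` carries the mass `1 / (n j)` (here `j` is `j + 1`), and this mass is given to the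
transposition `(i j)`, where `(i i)` is the identity. -/
def shuffleProb (n : ℕ) (τ : Sym n) : ℝ :=
  ∑ j : Fin n, ∑ i ∈ Finset.Iic j,
    if Equiv.swap i j = τ then (1 : ℝ) / ((n : ℝ) * ((j : ℕ) + 1 : ℝ)) else 0

/-- The transition matrix of the random walk on the symmetric group generated by `shuffleProb`. -/
def transitionMatrix (n : ℕ) : Matrix (Sym n) (Sym n) ℝ :=
  Matrix.of fun σ σ' => shuffleProb n (σ' * σ⁻¹)

/-- The complex group algebra of the symmetric group. -/
abbrev GroupAlg (n : ℕ) : Type := MonoidAlgebra ℂ (Sym n)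

/-- The shuffle as an element of the group algebra. -/
def shuffleElement (n : ℕ) : GroupAlg n :=
  ∑ τ : Sym n, MonoidAlgebra.single τ ((shuffleProb n τ : ℝ) : ℂ)

/-! ### Words -/

/-- Words of length `n`. The symbols are natural numbers; the symbol `0` is the first one.
A word whose evaluation is a partition of `n` only uses the symbols `0, …, n - 1`. -/
abbrev Word (n : ℕ) : Type := Fin n → ℕ

/-- The complex vector space with basis the words of length `n`. -/
abbrev WordSpace (n : ℕ) : Type := Word n →₀ ℂ

/-- A word as a basis vector. -/
def ofWord {n : ℕ} (w : Word n) : WordSpace n := Finsupp.single w 1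

/-- The action by place permutations: `σ (w_1 ⋯ w_n) = w_{σ⁻¹ 1} ⋯ w_{σ⁻¹ n}`. -/
def wordRep (n : ℕ) : Representation ℂ (Sym n) (WordSpace n) where
  toFun σ := Finsupp.lmapDomain ℂ ℂ (fun w : Word n => w ∘ (σ⁻¹ : Sym n))
  map_one' := by
    refine Finsupp.lhom_ext fun w c => ?_
    simp
  map_mul' σ τ := by
    refine Finsupp.lhom_ext fun w c => ?_
    simp [Finsupp.mapDomain_single, Function.comp_assoc, mul_inv_rev]

/-- The space of words as a module over the group algebra, through `wordRep`. -/
instance instModuleWordSpace (n : ℕ) : Module (GroupAlg n) (WordSpace n) :=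
  Module.compHom (WordSpace n) (wordRep n).asAlgebraHom.toRingHom

instance instIsScalarTowerWordSpace (n : ℕ) : IsScalarTower ℂ (GroupAlg n) (WordSpace n) where
  smul_assoc c a v := by
    change (wordRep n).asAlgebraHom (c • a) v = c • (wordRep n).asAlgebraHom a v
    simp

/-- The adding operator, which appends the symbol `a` at the end of each word. -/
def adding (n a : ℕ) : WordSpace n →ₗ[ℂ] WordSpace (n + 1) :=
  Finsupp.lmapDomain ℂ ℂ (fun w : Word n => (Fin.snoc w a : Word (n + 1)))

/-! ### Tableaux -/

/-- Standard Young tableaux of size `n` and shape `lam`. Mathlib's diagrams number rows and columns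
from `0`. The box `box p` is the one that contains the number `p + 1`. -/
structure StandardTableau (n : ℕ) (lam : YoungDiagram) where
  /-- the box containing a given number -/
  box : Fin n ≃ lam.cells
  /-- entries increase across rows -/
  row_lt : ∀ c d : lam.cells, c.1.1 = d.1.1 → c.1.2 < d.1.2 → box.symm c < box.symm d
  /-- entries increase down columns -/
  col_lt : ∀ c d : lam.cells, c.1.2 = d.1.2 → c.1.1 < d.1.1 → box.symm c < box.symm d

namespace StandardTableau

variable {n : ℕ} {lam : YoungDiagram}

/-- The number in a box, an element of `1, …, n`. -/
def entry (T : StandardTableau n lam) (c : lam.cells) : ℕ := (T.box.symm c : ℕ) + 1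

/-- Entries weakly increase to the right and downwards. -/
theorem symm_le (T : StandardTableau n lam) (c d : lam.cells) (h : c.1 ≤ d.1) :
    T.box.symm c ≤ T.box.symm d := by
  obtain ⟨⟨i, j⟩, hc⟩ := c
  obtain ⟨⟨k, l⟩, hd⟩ := d
  obtain ⟨hik, hjl⟩ : i ≤ k ∧ j ≤ l := h
  have he : (i, l) ∈ lam.cells := lam.isLowerSet (show (i, l) ≤ (k, l) from ⟨hik, le_rfl⟩) hd
  have h1 : T.box.symm ⟨(i, j), hc⟩ ≤ T.box.symm ⟨(i, l), he⟩ := by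
    rcases hjl.eq_or_lt with rfl | hlt
    · exact le_rfl
    · exact (T.row_lt ⟨(i, j), hc⟩ ⟨(i, l), he⟩ rfl hlt).le
  have h2 : T.box.symm ⟨(i, l), he⟩ ≤ T.box.symm ⟨(k, l), hd⟩ := by
    rcases hik.eq_or_lt with rfl | hlt
    · exact le_rfl
    · exact (T.col_lt ⟨(i, l), he⟩ ⟨(k, l), hd⟩ rfl hlt).le
  exact h1.trans h2

/-- The diagram formed by the boxes of `T` that contain the numbers `1, …, m`. For
`m = 0, …, n` these diagrams are the path in Young's lattice from the empty diagram to `lam` that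
adds the boxes of `T` in the order of their labels. -/
def shapeAt (T : StandardTableau n lam) (m : ℕ) : YoungDiagram where
  cells := (Finset.univ.filter fun p : Fin n => (p : ℕ) < m).image fun p => (T.box p).1
  isLowerSet := by
    intro c d hdc hc
    simp only [Finset.coe_image, Finset.coe_filter, Finset.mem_univ, true_and, Set.mem_image,
      Set.mem_ofPred_eq] at hc ⊢
    obtain ⟨p, hp, rfl⟩ := hc
    have hd : d ∈ lam.cells := lam.isLowerSet hdc (T.box p).2
    refine ⟨T.box.symm ⟨d, hd⟩, ?_, by simp⟩
    have := T.symm_le ⟨d, hd⟩ (T.box p) hdc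
    rw [Equiv.symm_apply_apply] at this
    exact lt_of_le_of_lt (Fin.le_def.mp this) hp

/-- The word `w(t)` of a filling `t` of `lam` by `1, …, n`: its `p`-th symbol is the row of the box
that contains `p`. -/
def word (t : Fin n ≃ lam.cells) : Word n := fun p => (t p).1.1

/-- The filling `σ(t)`, in which every entry `p` of `t` is replaced by `σ p`. -/
def permute (σ : Sym n) (t : Fin n ≃ lam.cells) : Fin n ≃ lam.cells := σ.symm.trans t

open Classical in
/-- The permutations that permute the entries in each column of `t`. -/
def colStab (t : Fin n ≃ lam.cells) : Finset (Sym n) :=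
  Finset.univ.filter fun σ => ∀ p, (t (σ p)).1.2 = (t p).1.2

/-- The vector `s(T) = ∑ sign(σ) w(σ(T))`, summed over the column stabilizer of `T`. -/
def polytabloid (T : StandardTableau n lam) : WordSpace n :=
  ∑ σ ∈ colStab T.box, ((Equiv.Perm.sign σ : ℤ) : ℂ) • ofWord (word (permute σ T.box))

end StandardTableau

/-- The Specht module of `lam` inside the space of words of length `n`: the submodule generated by
the vectors `s(T)`, where `T` runs over the standard Young tableaux of shape `lam`. -/
def specht (n : ℕ) (lam : YoungDiagram) : Submodule (GroupAlg n) (WordSpace n) :=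
  Submodule.span (GroupAlg n)
    (Set.range (StandardTableau.polytabloid : StandardTableau n lam → WordSpace n))

/-! ### Isotypic projections and lifting -/

section Isotypic

/-- Every submodule of a semisimple module is the image of a linear projection. -/
theorem exists_isotypicProj (A V S : Type*) [Ring A] [AddCommGroup V] [Module A V]
    [IsSemisimpleModule A V] [AddCommGroup S] [Module A S] :
    ∃ f : V →ₗ[A] V, (∀ v, f v ∈ isotypicComponent A V S) ∧
      ∀ v ∈ isotypicComponent A V S, f v = v := by
  obtain ⟨q, hq⟩ := exists_isCompl (isotypicComponent A V S)
  exact ⟨(isotypicComponent A V S).projection q hq, Submodule.projection_apply_mem hq,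
    fun v hv => Submodule.projection_apply_left hq ⟨v, hv⟩⟩

/-- The isotypic projection: the `A`-linear projection of the semisimple module `V` onto its
`S`-isotypic component. For simple `S` there is exactly one, see `isotypicProj_unique`. -/
def isotypicProj (A V S : Type*) [Ring A] [AddCommGroup V] [Module A V]
    [IsSemisimpleModule A V] [AddCommGroup S] [Module A S] : V →ₗ[A] V :=
  (exists_isotypicProj A V S).choose

/-- An `A`-linear projection onto an isotypic component is unique. -/
theorem isotypicProj_unique (A V S : Type*) [Ring A] [AddCommGroup V] [Module A V]
    [IsSemisimpleModule A V] [AddCommGroup S] [Module A S] [IsSimpleModule A S]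
    (f : V →ₗ[A] V) (hf : ∀ v, f v ∈ isotypicComponent A V S)
    (hf' : ∀ v ∈ isotypicComponent A V S, f v = v) : f = isotypicProj A V S := by
  obtain ⟨hg, hg'⟩ := (exists_isotypicProj A V S).choose_spec
  change f = (exists_isotypicProj A V S).choose
  set g := (exists_isotypicProj A V S).choose
  set h : V →ₗ[A] V := f - g with hh
  have hI : ∀ v ∈ isotypicComponent A V S, h v = 0 := fun v hv => by
    simp [hh, hf' v hv, hg' v hv]
  have hr : LinearMap.range h ≤ isotypicComponent A V S := by
    rintro _ ⟨v, rfl⟩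
    exact Submodule.sub_mem _ (hf v) (hg v)
  suffices LinearMap.range h = ⊥ from sub_eq_zero.mp (LinearMap.range_eq_bot.mp this)
  rcases IsSemisimpleModule.eq_bot_or_exists_simple_le (LinearMap.range h) with h0 | ⟨N, hN, hs⟩
  · exact h0
  · exfalso
    obtain ⟨q, hq⟩ := IsSemisimpleModule.lifting_property h.rangeRestrict
      h.surjective_rangeRestrict (Submodule.inclusion hN)
    obtain ⟨e⟩ := isIsotypicOfType_submodule_iff.mp
      (IsIsotypicOfType.isotypicComponent A V S) N (hN.trans hr)
    have hz : ∀ x : N, (x : V) = 0 := fun x => by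
      have h1 : q x ∈ isotypicComponent A V S := by
        rw [← e.isotypicComponent_eq]
        have h2 := LinearMap.le_comap_isotypicComponent N q
        have h3 : isotypicComponent A N N = ⊤ :=
          isotypicComponent_eq_top_iff.mpr (IsIsotypicOfType.of_isSimpleModule A N)
        rw [h3] at h2
        exact h2 Submodule.mem_top
      have h4 := congrArg Subtype.val (LinearMap.congr_fun hq x)
      simp only [LinearMap.comp_apply, LinearMap.codRestrict_apply] at h4
      exact h4.symm.trans (hI _ h1)
    have := IsSimpleModule.nontrivial A N
    obtain ⟨x, hx⟩ := exists_ne (0 : N)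
    exact hx (Subtype.ext (hz x))

end Isotypic

/-- The lifting operator `π^μ ∘ Φ_a`: append the symbol `a`, then project onto the isotypic component
of the Specht module of `mu`. -/
def lifting (n a : ℕ) (mu : YoungDiagram) : WordSpace n →ₗ[ℂ] WordSpace (n + 1) :=
  (isotypicProj (GroupAlg (n + 1)) (WordSpace (n + 1)) (specht (n + 1) mu)).restrictScalars ℂ ∘ₗ
    adding n a

namespace StandardTableau

variable {n : ℕ} {lam : YoungDiagram}

/-- The vector obtained from the empty word by adding the boxes containing `1, …, m` in this order
and applying the corresponding lifting operator each time. -/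
def liftedUpTo (T : StandardTableau n lam) : (m : ℕ) → m ≤ n → WordSpace m
  | 0, _ => ofWord Fin.elim0
  | m + 1, h =>
      lifting m (T.box ⟨m, h⟩).1.1 (T.shapeAt (m + 1)) (T.liftedUpTo m (Nat.le_of_succ_le h))

/-- The lifted vector attached to a standard Young tableau. -/
def lifted (T : StandardTableau n lam) : WordSpace n := T.liftedUpTo n le_rfl

end StandardTableau

/-- The action of the shuffle on the space of words of length `n`. -/
def shuffleOp (n : ℕ) : Module.End ℂ (WordSpace n) :=
  Algebra.lsmul ℂ ℂ (WordSpace n) (shuffleElement n)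

end OneSided

end

open scoped BigOperators

noncomputable section

namespace OneSided

/-! ### The action on words -/

theorem single_one_smul {n : ℕ} (σ : Sym n) (v : WordSpace n) :
    (MonoidAlgebra.single σ (1 : ℂ) : GroupAlg n) • v = wordRep n σ v := by
  change (wordRep n).asAlgebraHom (MonoidAlgebra.single σ (1 : ℂ)) v = _
  simp

theorem single_smul {n : ℕ} (σ : Sym n) (z : ℂ) (v : WordSpace n) :
    (MonoidAlgebra.single σ z : GroupAlg n) • v = z • wordRep n σ v := by
  change (wordRep n).asAlgebraHom (MonoidAlgebra.single σ z) v = _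
  simp

theorem wordRep_ofWord {n : ℕ} (σ : Sym n) (w : Word n) :
    wordRep n σ (ofWord w) = ofWord (w ∘ (σ⁻¹ : Sym n)) := by
  simp [wordRep, ofWord, Finsupp.mapDomain_single]

theorem wordRep_apply {n : ℕ} (σ : Sym n) (v : WordSpace n) (w : Word n) :
    wordRep n σ v w = v (w ∘ σ) := by
  have hinj : Function.Injective (fun w : Word n => w ∘ (σ⁻¹ : Sym n)) :=
    σ⁻¹.surjective.injective_comp_right
  have hw : w = (fun w : Word n => w ∘ (σ⁻¹ : Sym n)) (w ∘ σ) := by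
    ext p; simp
  conv_lhs => rw [hw]
  exact Finsupp.mapDomain_apply hinj v _

theorem wordRep_mul_apply {n : ℕ} (σ τ : Sym n) (v : WordSpace n) :
    wordRep n (σ * τ) v = wordRep n σ (wordRep n τ v) := by
  simp [map_mul]

theorem wordRep_mem {n : ℕ} (N : Submodule (GroupAlg n) (WordSpace n)) (σ : Sym n)
    {v : WordSpace n} (hv : v ∈ N) : wordRep n σ v ∈ N := by
  rw [← single_one_smul]
  exact N.smul_mem _ hv

theorem complex_smul_mem {n : ℕ} (N : Submodule (GroupAlg n) (WordSpace n)) (z : ℂ)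
    {v : WordSpace n} (hv : v ∈ N) : z • v ∈ N := by
  have : z • v = (z • (1 : GroupAlg n)) • v := by rw [smul_assoc, one_smul]
  rw [this]
  exact N.smul_mem _ hv

/-- A property of vectors holds on the submodule generated by a vector `x` as soon as it holds on
the translates of `x` and is stable under linear combinations. -/
theorem span_singleton_induction {n : ℕ} {x : WordSpace n} (K : Submodule ℂ (WordSpace n))
    (h : ∀ σ : Sym n, wordRep n σ x ∈ K) {v : WordSpace n}
    (hv : v ∈ Submodule.span (GroupAlg n) {x}) : v ∈ K := by
  obtain ⟨a, rfl⟩ := Submodule.mem_span_singleton.mp hv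
  induction a using MonoidAlgebra.induction_linear with
  | zero => rw [zero_smul]; exact K.zero_mem
  | add a b ha hb =>
    rw [add_smul]
    exact K.add_mem (ha (Submodule.smul_mem _ _ (Submodule.mem_span_singleton_self x)))
      (hb (Submodule.smul_mem _ _ (Submodule.mem_span_singleton_self x)))
  | single σ z =>
    rw [single_smul]
    exact K.smul_mem _ (h σ)

/-! ### Column antisymmetrizers -/

/-- The permutations that preserve the column of every position of a filling `b`. -/
def columnStabilizer {n : ℕ} (b : Fin n → ℕ × ℕ) : Subgroup (Sym n) where
  carrier := {σ | ∀ p, (b (σ p)).2 = (b p).2}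
  mul_mem' := by
    intro σ τ hσ hτ p
    rw [Equiv.Perm.mul_apply, hσ, hτ]
  one_mem' := fun _ => rfl
  inv_mem' := by
    intro σ hσ p
    have := hσ (σ⁻¹ p)
    simpa using this.symm

theorem mem_columnStabilizer {n : ℕ} {b : Fin n → ℕ × ℕ} {σ : Sym n} :
    σ ∈ columnStabilizer b ↔ ∀ p, (b (σ p)).2 = (b p).2 := Iff.rfl

open Classical in
/-- The signed sum of the column stabilizer of a filling. -/
def antisymmetrizer {n : ℕ} (b : Fin n → ℕ × ℕ) : GroupAlg n :=
  ∑ σ : Sym n, if σ ∈ columnStabilizer b then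
    MonoidAlgebra.single σ ((Equiv.Perm.sign σ : ℤ) : ℂ) else 0

/-- The rows of a filling, as a word. -/
def rowWord {n : ℕ} (b : Fin n → ℕ × ℕ) : Word n := fun p => (b p).1

/-- The polytabloid of a filling. -/
def fillingVector {n : ℕ} (b : Fin n → ℕ × ℕ) : WordSpace n :=
  antisymmetrizer b • ofWord (rowWord b)

open Classical in
theorem antisymmetrizer_smul {n : ℕ} (b : Fin n → ℕ × ℕ) (v : WordSpace n) :
    antisymmetrizer b • v = ∑ σ : Sym n, if σ ∈ columnStabilizer b then
      ((Equiv.Perm.sign σ : ℤ) : ℂ) • wordRep n σ v else 0 := by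
  rw [antisymmetrizer, Finset.sum_smul]
  refine Finset.sum_congr rfl fun σ _ => ?_
  split_ifs
  · rw [single_smul]
  · rw [zero_smul]

theorem sign_mul_self_complex {n : ℕ} (σ : Sym n) :
    ((Equiv.Perm.sign σ : ℤ) : ℂ) * ((Equiv.Perm.sign σ : ℤ) : ℂ) = 1 := by
  rcases Int.units_eq_one_or (Equiv.Perm.sign σ) with h | h <;> simp [h]

open Classical in
theorem antisymmetrizer_mul_single {n : ℕ} (b : Fin n → ℕ × ℕ) {τ : Sym n}
    (hτ : τ ∈ columnStabilizer b) :
    antisymmetrizer b * MonoidAlgebra.single τ (1 : ℂ) =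
      ((Equiv.Perm.sign τ : ℤ) : ℂ) • antisymmetrizer b := by
  rw [antisymmetrizer, Finset.sum_mul, Finset.smul_sum]
  refine Fintype.sum_equiv (Equiv.mulRight τ) _ _ fun σ => ?_
  simp only [Equiv.coe_mulRight, (columnStabilizer b).mul_mem_cancel_right hτ]
  split_ifs
  · rw [MonoidAlgebra.single_mul_single, MonoidAlgebra.smul_single]
    congr 1
    simp only [Equiv.Perm.sign_mul, Units.val_mul, Int.cast_mul, smul_eq_mul, mul_one]
    linear_combination (-((Equiv.Perm.sign σ : ℤ) : ℂ)) * sign_mul_self_complex τ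
  · simp

theorem antisymmetrizer_smul_wordRep {n : ℕ} (b : Fin n → ℕ × ℕ) {τ : Sym n}
    (hτ : τ ∈ columnStabilizer b) (v : WordSpace n) :
    antisymmetrizer b • wordRep n τ v =
      ((Equiv.Perm.sign τ : ℤ) : ℂ) • (antisymmetrizer b • v) := by
  rw [← single_one_smul, ← mul_smul, antisymmetrizer_mul_single b hτ, smul_assoc]

theorem smul_complex_smul {n : ℕ} (a : GroupAlg n) (z : ℂ) (v : WordSpace n) :
    a • (z • v) = z • (a • v) :=
  smul_algebra_smul_comm z a v

/-- The antisymmetrizer is idempotent up to a nonzero scalar. -/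
theorem exists_antisymmetrizer_smul_smul {n : ℕ} (b : Fin n → ℕ × ℕ) :
    ∃ z : ℂ, z ≠ 0 ∧ ∀ v : WordSpace n,
      antisymmetrizer b • (antisymmetrizer b • v) = z • (antisymmetrizer b • v) := by
  classical
  refine ⟨((Finset.univ.filter fun σ : Sym n => σ ∈ columnStabilizer b).card : ℂ), ?_, ?_⟩
  · rw [Nat.cast_ne_zero, ← Nat.pos_iff_ne_zero, Finset.card_pos]
    exact ⟨1, by simp [(columnStabilizer b).one_mem]⟩
  · intro v
    conv_lhs => rw [antisymmetrizer_smul b v, Finset.smul_sum]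
    rw [← Finset.sum_boole, Finset.sum_smul]
    refine Finset.sum_congr rfl fun σ _ => ?_
    split_ifs with h
    · rw [smul_complex_smul, antisymmetrizer_smul_wordRep b h, smul_smul, sign_mul_self_complex]
    · simp

open Classical in
theorem antisymmetrizer_comp {n : ℕ} (b : Fin n → ℕ × ℕ) (τ : Sym n) (v : WordSpace n) :
    antisymmetrizer (b ∘ τ) • v = wordRep n τ⁻¹ (antisymmetrizer b • wordRep n τ v) := by
  rw [antisymmetrizer_smul, antisymmetrizer_smul, map_sum]
  refine Fintype.sum_equiv (MulAut.conj τ).toEquiv _ _ fun σ => ?_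
  have h : (MulAut.conj τ) σ ∈ columnStabilizer b ↔ σ ∈ columnStabilizer (b ∘ τ) := by
    simp only [mem_columnStabilizer, MulAut.conj_apply, Equiv.Perm.mul_apply, Function.comp_apply]
    constructor
    · intro h p
      simpa using h (τ p)
    · intro h p
      simpa using h (τ⁻¹ p)
  simp only [MulEquiv.toEquiv_eq_coe, MulEquiv.coe_toEquiv, h]
  split_ifs
  · rw [map_smul, ← wordRep_mul_apply, ← wordRep_mul_apply]
    have h1 : τ⁻¹ * (MulAut.conj τ) σ * τ = σ := by simp [MulAut.conj_apply, mul_assoc]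
    have h2 : Equiv.Perm.sign ((MulAut.conj τ) σ) = Equiv.Perm.sign σ := by
      rw [MulAut.conj_apply, Equiv.Perm.sign_mul, Equiv.Perm.sign_mul, Equiv.Perm.sign_inv,
        mul_comm (Equiv.Perm.sign τ), mul_assoc, Int.units_mul_self, mul_one]
    rw [h1, h2]
  · simp

theorem fillingVector_comp {n : ℕ} (b : Fin n → ℕ × ℕ) (τ : Sym n) :
    fillingVector (b ∘ τ) = wordRep n τ⁻¹ (fillingVector b) := by
  rw [fillingVector, antisymmetrizer_comp, wordRep_ofWord]
  have : rowWord (b ∘ τ) ∘ (τ⁻¹ : Sym n) = rowWord b := by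
    ext p; simp [rowWord]
  rw [this]
  rfl

/-! ### Fillings of diagrams and the line generated by a polytabloid -/

/-- The map `b` is a bijective filling of the diagram with column lengths `h`. -/
structure IsFilling {n : ℕ} (h : ℕ → ℕ) (b : Fin n → ℕ × ℕ) : Prop where
  injective : Function.Injective b
  exists_iff : ∀ i j, (∃ p, b p = (i, j)) ↔ i < h j

theorem IsFilling.comp {n : ℕ} {h : ℕ → ℕ} {b : Fin n → ℕ × ℕ} (hb : IsFilling h b) (σ : Sym n) :
    IsFilling h (b ∘ σ) where
  injective := hb.injective.comp σ.injective
  exists_iff i j := by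
    rw [← hb.exists_iff]
    exact ⟨fun ⟨p, hp⟩ => ⟨σ p, hp⟩, fun ⟨p, hp⟩ => ⟨σ⁻¹ p, by simpa using hp⟩⟩

theorem IsFilling.exists_comp_eq {n : ℕ} {h : ℕ → ℕ} {b b' : Fin n → ℕ × ℕ} (hb : IsFilling h b)
    (hb' : IsFilling h b') : ∃ σ : Sym n, b' = b ∘ σ := by
  have : ∀ p, ∃ q, b q = b' p := fun p =>
    (hb.exists_iff _ _).mpr ((hb'.exists_iff (b' p).1 (b' p).2).mp ⟨p, rfl⟩)
  choose f hf using this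
  have hinj : Function.Injective f := fun p q hpq => hb'.injective (by rw [← hf p, hpq, hf q])
  refine ⟨Equiv.ofBijective f (Finite.injective_iff_bijective.mp hinj), ?_⟩
  ext1 p
  exact (hf p).symm

theorem swap_mem_columnStabilizer {n : ℕ} {b : Fin n → ℕ × ℕ} {p q : Fin n}
    (h : (b p).2 = (b q).2) : Equiv.swap p q ∈ columnStabilizer b := by
  intro x
  rw [Equiv.swap_apply_def]
  split_ifs with h1 h2
  · rw [h1, h]
  · rw [h2, h]
  · rfl

theorem comp_swap_eq_self {n : ℕ} {w : Word n} {p q : Fin n} (h : w p = w q) :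
    w ∘ Equiv.swap p q = w := by
  ext x
  rw [Function.comp_apply, Equiv.swap_apply_def]
  split_ifs with h1 h2
  · rw [h1, h]
  · rw [h2, h]
  · rfl

/-- An antisymmetrizer kills the words with a repeated symbol in a column. -/
theorem antisymmetrizer_smul_ofWord_eq_zero {n : ℕ} {b : Fin n → ℕ × ℕ} {w : Word n} {p q : Fin n}
    (hpq : p ≠ q) (hc : (b p).2 = (b q).2) (hw : w p = w q) :
    antisymmetrizer b • ofWord w = 0 := by
  have h := antisymmetrizer_smul_wordRep b (swap_mem_columnStabilizer hc) (ofWord w)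
  rw [wordRep_ofWord, Equiv.swap_inv, comp_swap_eq_self hw, Equiv.Perm.sign_swap hpq] at h
  simpa [self_eq_neg] using h

theorem IsFilling.card_col_lt {n : ℕ} {h : ℕ → ℕ} {b : Fin n → ℕ × ℕ} (hb : IsFilling h b)
    (j k : ℕ) : (Finset.univ.filter fun p => (b p).2 = j ∧ (b p).1 < k).card = min k (h j) := by
  rw [← Finset.card_range (min k (h j))]
  refine Finset.card_bij (fun p _ => (b p).1) ?_ ?_ ?_
  · intro p hp
    simp only [Finset.mem_filter, Finset.mem_univ, true_and] at hp
    rw [Finset.mem_range, lt_min_iff]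
    exact ⟨hp.2, (hb.exists_iff _ _).mp ⟨p, by rw [← hp.1]⟩⟩
  · intro p hp q hq hpq
    simp only [Finset.mem_filter, Finset.mem_univ, true_and] at hp hq
    exact hb.injective (Prod.ext hpq (hp.1.trans hq.1.symm))
  · intro i hi
    rw [Finset.mem_range, lt_min_iff] at hi
    obtain ⟨p, hp⟩ := (hb.exists_iff _ _).mpr hi.2
    exact ⟨p, by simp [hp, hi.1], by rw [hp]⟩

theorem IsFilling.card_col {n : ℕ} {h : ℕ → ℕ} {b : Fin n → ℕ × ℕ} (hb : IsFilling h b)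
    (j : ℕ) : (Finset.univ.filter fun p => (b p).2 = j).card = h j := by
  rw [← min_self (h j), ← hb.card_col_lt j (h j)]
  congr 1
  ext p
  simp only [Finset.mem_filter, Finset.mem_univ, true_and]
  refine ⟨fun hp => ⟨hp, (hb.exists_iff _ _).mp ⟨p, by rw [← hp]⟩⟩, fun hp => hp.1⟩

/-- A rearrangement of the row word with distinct symbols in each column has in each column the same
symbols as the row word. -/
theorem IsFilling.lt_of_injective {n : ℕ} {h : ℕ → ℕ} {b : Fin n → ℕ × ℕ} (hb : IsFilling h b)
    (τ : Sym n) (hw : ∀ p q, (b p).2 = (b q).2 → rowWord b (τ p) = rowWord b (τ q) → p = q)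
    (p : Fin n) : rowWord b (τ p) < h (b p).2 := by
  classical
  set k := h (b p).2 with hk
  have hcol : ∀ j, (Finset.univ.filter fun q => (b q).2 = j ∧ rowWord b (τ q) < k).card ≤
      (Finset.univ.filter fun q => (b q).2 = j ∧ (b q).1 < k).card := by
    intro j
    rw [hb.card_col_lt, le_min_iff]
    constructor
    · conv_rhs => rw [← Finset.card_range k]
      refine Finset.card_le_card_of_injOn (fun q => rowWord b (τ q)) ?_ ?_
      · intro q hq
        simpa using (Finset.mem_filter.mp hq).2.2
      · intro q hq q' hq' hqq
        exact hw _ _ ((Finset.mem_filter.mp hq).2.1.trans (Finset.mem_filter.mp hq').2.1.symm) hqq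
    · rw [← hb.card_col j]
      exact Finset.card_le_card fun q hq => by
        simp only [Finset.mem_filter] at hq ⊢
        exact ⟨hq.1, hq.2.1⟩
  have htot : (Finset.univ.filter fun q => rowWord b (τ q) < k).card =
      (Finset.univ.filter fun q => (b q).1 < k).card := by
    refine Finset.card_equiv τ fun q => ?_
    rw [Finset.mem_filter, Finset.mem_filter]
    simp only [Finset.mem_univ, true_and]
    rfl
  have hsum : ∀ f : Fin n → ℕ, (Finset.univ.filter fun q => f q < k).card =
      ∑ j ∈ Finset.univ.image fun q => (b q).2,
        (Finset.univ.filter fun q => (b q).2 = j ∧ f q < k).card := by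
    intro f
    rw [Finset.card_eq_sum_card_fiberwise (f := fun q => (b q).2)
      (t := Finset.univ.image fun q => (b q).2) (by intro q _; simp)]
    refine Finset.sum_congr rfl fun j _ => ?_
    rw [Finset.filter_filter]
    congr 1
    ext q
    simp [and_comm]
  rw [hsum (fun q => rowWord b (τ q)), hsum (fun q => (b q).1)] at htot
  have heq := (Finset.sum_eq_sum_iff_of_le fun j _ => hcol j).mp htot (b p).2 (by simp)
  rw [hb.card_col_lt, ← hk, min_self] at heq
  have hsub := Finset.eq_of_subset_of_card_le (fun q hq => by
    simp only [Finset.mem_filter] at hq ⊢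
    exact ⟨hq.1, hq.2.1⟩) ((hb.card_col (b p).2).trans heq.symm).le
  have hp : p ∈ Finset.univ.filter fun q => (b q).2 = (b p).2 := by simp
  rw [← hsub] at hp
  exact (Finset.mem_filter.mp hp).2.2

theorem IsFilling.exists_mem_columnStabilizer {n : ℕ} {h : ℕ → ℕ} {b : Fin n → ℕ × ℕ}
    (hb : IsFilling h b) (τ : Sym n)
    (hw : ∀ p q, (b p).2 = (b q).2 → rowWord b (τ p) = rowWord b (τ q) → p = q) :
    ∃ σ ∈ columnStabilizer b, rowWord b ∘ τ = rowWord b ∘ σ := by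
  have : ∀ p, ∃ q, b q = (rowWord b (τ p), (b p).2) := fun p =>
    (hb.exists_iff _ _).mpr (hb.lt_of_injective τ hw p)
  choose f hf using this
  have hinj : Function.Injective f := fun p q hpq => by
    have h1 := hf p
    rw [hpq, hf q, Prod.mk.injEq] at h1
    exact hw p q h1.2.symm h1.1.symm
  refine ⟨Equiv.ofBijective f (Finite.injective_iff_bijective.mp hinj), fun p => ?_, ?_⟩
  · simp [hf]
  · ext p
    simp [rowWord, hf]

/-- The cyclic module generated by the row word of a filling. -/
def wordModule {n : ℕ} (b : Fin n → ℕ × ℕ) : Submodule (GroupAlg n) (WordSpace n) :=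
  Submodule.span (GroupAlg n) {ofWord (rowWord b)}

/-- The cyclic module generated by the polytabloid of a filling. -/
def fillingModule {n : ℕ} (b : Fin n → ℕ × ℕ) : Submodule (GroupAlg n) (WordSpace n) :=
  Submodule.span (GroupAlg n) {fillingVector b}

theorem fillingVector_mem {n : ℕ} (b : Fin n → ℕ × ℕ) : fillingVector b ∈ fillingModule b :=
  Submodule.mem_span_singleton_self _

theorem ofWord_rowWord_mem {n : ℕ} (b : Fin n → ℕ × ℕ) : ofWord (rowWord b) ∈ wordModule b :=
  Submodule.mem_span_singleton_self _

theorem ofWord_comp_mem_wordModule {n : ℕ} (b : Fin n → ℕ × ℕ) (σ : Sym n) :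
    ofWord (rowWord b ∘ σ) ∈ wordModule b := by
  have := wordRep_mem (wordModule b) σ⁻¹ (ofWord_rowWord_mem b)
  rwa [wordRep_ofWord, inv_inv] at this

theorem fillingModule_le_wordModule {n : ℕ} (b : Fin n → ℕ × ℕ) :
    fillingModule b ≤ wordModule b := by
  rw [fillingModule, Submodule.span_singleton_le_iff_mem]
  exact Submodule.smul_mem _ _ (ofWord_rowWord_mem b)

theorem wordModule_comp {n : ℕ} (b : Fin n → ℕ × ℕ) (τ : Sym n) :
    wordModule (b ∘ τ) = wordModule b := by
  apply le_antisymm <;> rw [wordModule, Submodule.span_singleton_le_iff_mem]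
  · exact ofWord_comp_mem_wordModule b τ
  · have := ofWord_comp_mem_wordModule (b ∘ τ) τ⁻¹
    have h : rowWord (b ∘ τ) ∘ (τ⁻¹ : Sym n) = rowWord b := by ext p; simp [rowWord]
    rwa [h] at this

theorem fillingModule_comp {n : ℕ} (b : Fin n → ℕ × ℕ) (τ : Sym n) :
    fillingModule (b ∘ τ) = fillingModule b := by
  apply le_antisymm <;> rw [fillingModule, Submodule.span_singleton_le_iff_mem]
  · rw [fillingVector_comp]
    exact wordRep_mem _ _ (fillingVector_mem b)
  · have h : fillingVector b = wordRep n τ (fillingVector (b ∘ τ)) := by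
      rw [fillingVector_comp, ← wordRep_mul_apply]
      simp
    rw [h]
    exact wordRep_mem _ _ (fillingVector_mem _)

/-- The antisymmetrizer of a filling maps the module generated by its row word to a line. -/
theorem IsFilling.exists_smul_fillingVector {n : ℕ} {h : ℕ → ℕ} {b : Fin n → ℕ × ℕ}
    (hb : IsFilling h b) {u : WordSpace n} (hu : u ∈ wordModule b) :
    ∃ z : ℂ, antisymmetrizer b • u = z • fillingVector b := by
  have hlin : u ∈ (Submodule.span ℂ {fillingVector b}).comap
      (Algebra.lsmul ℂ ℂ (WordSpace n) (antisymmetrizer b)) := by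
    refine span_singleton_induction _ (fun τ => ?_) hu
    rw [Submodule.mem_comap, wordRep_ofWord]
    change antisymmetrizer b • ofWord (rowWord b ∘ (τ⁻¹ : Sym n)) ∈ _
    by_cases hw : ∀ p q, (b p).2 = (b q).2 → rowWord b (τ⁻¹ p) = rowWord b (τ⁻¹ q) → p = q
    · obtain ⟨σ, hσ, he⟩ := hb.exists_mem_columnStabilizer τ⁻¹ hw
      have h1 := antisymmetrizer_smul_wordRep b (inv_mem hσ) (ofWord (rowWord b))
      rw [wordRep_ofWord, inv_inv] at h1
      rw [he, h1]
      exact Submodule.smul_mem _ _ (Submodule.mem_span_singleton_self _)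
    · push Not at hw
      obtain ⟨p, q, hc, hr, hpq⟩ := hw
      rw [antisymmetrizer_smul_ofWord_eq_zero (w := rowWord b ∘ (τ⁻¹ : Sym n)) hpq hc hr]
      exact Submodule.zero_mem _
  obtain ⟨z, hz⟩ := Submodule.mem_span_singleton.mp hlin
  exact ⟨z, hz.symm⟩

/-- The coefficients of an antisymmetrized vector. -/
theorem antisymmetrizer_smul_apply {n : ℕ} (b : Fin n → ℕ × ℕ) (v : WordSpace n) (w : Word n) :
    (antisymmetrizer b • v) w = ∑ σ : Sym n, open Classical in if σ ∈ columnStabilizer b then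
      ((Equiv.Perm.sign σ : ℤ) : ℂ) * v (w ∘ σ) else 0 := by
  rw [antisymmetrizer_smul, Finsupp.finsetSum_apply]
  refine Finset.sum_congr rfl fun σ _ => ?_
  split_ifs
  · rw [Finsupp.smul_apply, wordRep_apply, smul_eq_mul]
  · rfl

theorem fillingVector_apply_rowWord {n : ℕ} {b : Fin n → ℕ × ℕ} (hb : Function.Injective b) :
    fillingVector b (rowWord b) = 1 := by
  classical
  rw [fillingVector, antisymmetrizer_smul_apply, Finset.sum_eq_single (1 : Sym n)]
  · simp [(columnStabilizer b).one_mem, ofWord]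
  · intro σ _ hσ
    split_ifs with h
    · rw [ofWord, Finsupp.single_apply, if_neg, mul_zero]
      intro he
      refine hσ (Equiv.ext fun p => hb (Prod.ext ?_ (h p)))
      exact (congrFun he p).symm
    · rfl
  · simp

theorem fillingVector_ne_zero {n : ℕ} {b : Fin n → ℕ × ℕ} (hb : Function.Injective b) :
    fillingVector b ≠ 0 := fun h => by
  have := fillingVector_apply_rowWord hb
  simp [h] at this

/-! ### Simplicity of the module of a filling and the isotypic projection -/

/-- Homomorphisms from the module of a filling to the word module are scalars. -/
theorem IsFilling.exists_eq_smul {n : ℕ} {h : ℕ → ℕ} {b : Fin n → ℕ × ℕ} (hb : IsFilling h b)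
    (θ : fillingModule b →ₗ[GroupAlg n] WordSpace n)
    (hθ : θ ⟨fillingVector b, fillingVector_mem b⟩ ∈ wordModule b) :
    ∃ z : ℂ, ∀ x, θ x = z • (x : WordSpace n) := by
  obtain ⟨y, hy, hyy⟩ := exists_antisymmetrizer_smul_smul b
  obtain ⟨z, hz⟩ := hb.exists_smul_fillingVector hθ
  have h1 : antisymmetrizer b • (⟨fillingVector b, fillingVector_mem b⟩ : fillingModule b) =
      (y • (1 : GroupAlg n)) • ⟨fillingVector b, fillingVector_mem b⟩ := by
    refine Subtype.ext ?_
    change antisymmetrizer b • fillingVector b = (y • (1 : GroupAlg n)) • fillingVector b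
    rw [smul_assoc, one_smul]
    exact hyy _
  rw [← map_smul, h1, map_smul, smul_assoc, one_smul] at hz
  refine ⟨y⁻¹ * z, fun x => ?_⟩
  obtain ⟨a, ha⟩ := Submodule.mem_span_singleton.mp x.2
  have hx : x = a • (⟨fillingVector b, fillingVector_mem b⟩ : fillingModule b) :=
    Subtype.ext ha.symm
  have h2 : θ ⟨fillingVector b, fillingVector_mem b⟩ = (y⁻¹ * z) • fillingVector b := by
    rw [mul_smul, ← hz, inv_smul_smul₀ hy]
  rw [hx, map_smul, h2, smul_complex_smul]
  rfl

/-- A semisimple module without nontrivial idempotent endomorphisms is simple. -/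
theorem isSimpleModule_of_forall_idempotent {A S : Type*} [Ring A] [AddCommGroup S] [Module A S]
    [IsSemisimpleModule A S] [Nontrivial S]
    (h : ∀ e : S →ₗ[A] S, (∀ x, e (e x) = e x) → e = 0 ∨ e = LinearMap.id) :
    IsSimpleModule A S := by
  rw [isSimpleModule_iff]
  refine { eq_bot_or_eq_top := fun N => ?_ }
  obtain ⟨N', hN⟩ := exists_isCompl N
  have hid : ∀ x ∈ N, N.projection N' hN x = x := fun x hx =>
    Submodule.projection_apply_left hN ⟨x, hx⟩
  rcases h (N.projection N' hN) fun x => hid _ (Submodule.projection_apply_mem hN x) with h0 | h1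
  · left
    rw [eq_bot_iff]
    intro x hx
    have := hid x hx
    rw [h0] at this
    exact this.symm
  · right
    rw [eq_top_iff]
    intro x _
    have := Submodule.projection_apply_mem hN x
    rwa [h1] at this

theorem IsFilling.isSimpleModule {n : ℕ} {h : ℕ → ℕ} {b : Fin n → ℕ × ℕ} (hb : IsFilling h b) :
    IsSimpleModule (GroupAlg n) (fillingModule b) := by
  have hne : (⟨fillingVector b, fillingVector_mem b⟩ : fillingModule b) ≠ 0 := fun h0 =>
    fillingVector_ne_zero hb.injective (congrArg Subtype.val h0)
  have : Nontrivial (fillingModule b) := ⟨_, _, hne⟩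
  refine isSimpleModule_of_forall_idempotent fun e he => ?_
  obtain ⟨z, hz⟩ := hb.exists_eq_smul ((fillingModule b).subtype ∘ₗ e)
    (fillingModule_le_wordModule b (Subtype.prop _))
  have hz' : ∀ x, e x = z • x := fun x => Subtype.ext (hz x)
  by_cases h0 : z = 0
  · left
    refine LinearMap.ext fun x => ?_
    rw [hz', h0, zero_smul]
    rfl
  · right
    refine LinearMap.ext fun x => ?_
    have h1 := congrArg (z⁻¹ • ·) (he x)
    simp only [hz', inv_smul_smul₀ h0] at h1
    rw [hz', h1]
    rfl

/-- A projection onto an isotypic component maps a submodule `W` into a submodule `Y` of the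
component if all homomorphisms from the simple type to `W` have image in `Y`. -/
theorem isotypicProj_mem {A V S : Type*} [Ring A] [AddCommGroup V] [Module A V]
    [IsSemisimpleModule A V] [AddCommGroup S] [Module A S] [IsSimpleModule A S]
    (W Y : Submodule A V) (hY : Y ≤ isotypicComponent A V S)
    (hW : ∀ θ : S →ₗ[A] V, (∀ x, θ x ∈ W) → ∀ x, θ x ∈ Y) {w : V} (hw : w ∈ W) :
    isotypicProj A V S w ∈ Y := by
  obtain ⟨hg, hg'⟩ := (exists_isotypicProj A V S).choose_spec
  change ∀ v, isotypicProj A V S v ∈ _ at hg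
  change ∀ v ∈ _, isotypicProj A V S v = v at hg'
  set f := isotypicProj A V S
  suffices W.map f ≤ Y from this (Submodule.mem_map_of_mem hw)
  rw [← IsSemisimpleModule.sSup_simples_le (W.map f)]
  refine sSup_le fun N ⟨hN, hNW⟩ => ?_
  have hsurj : Function.Surjective (f.submoduleMap W) := f.submoduleMap_surjective W
  obtain ⟨q, hq⟩ := IsSemisimpleModule.lifting_property (f.submoduleMap W) hsurj
    (Submodule.inclusion hNW)
  have hNI : N ≤ isotypicComponent A V S := fun x hx => by
    obtain ⟨u, -, rfl⟩ := hNW hx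
    exact hg u
  obtain ⟨e⟩ := isIsotypicOfType_submodule_iff.mp
    (IsIsotypicOfType.isotypicComponent A V S) N hNI
  intro x hx
  have h1 := hW (W.subtype ∘ₗ q ∘ₗ e.symm.toLinearMap) (fun y => (q (e.symm y)).2) (e ⟨x, hx⟩)
  simp only [LinearMap.comp_apply, LinearEquiv.coe_coe, LinearEquiv.symm_apply_apply,
    Submodule.subtype_apply] at h1
  have h2 := congrArg Subtype.val (LinearMap.congr_fun hq ⟨x, hx⟩)
  have h3 : f (q ⟨x, hx⟩ : V) = x := h2
  rw [hg' _ (hY h1)] at h3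
  rwa [h3] at h1

theorem le_isotypicComponent {A V : Type*} [Ring A] [AddCommGroup V] [Module A V]
    (S : Submodule A V) : S ≤ isotypicComponent A V S :=
  le_sSup ⟨LinearEquiv.refl A S⟩

theorem isotypicProj_apply_of_mem {A V : Type*} [Ring A] [AddCommGroup V] [Module A V]
    [IsSemisimpleModule A V] (S : Submodule A V) {v : V} (hv : v ∈ S) :
    isotypicProj A V S v = v :=
  (exists_isotypicProj A V S).choose_spec.2 v (le_isotypicComponent S hv)

theorem IsFilling.isotypicProj_mem {n : ℕ} {h : ℕ → ℕ} {b : Fin n → ℕ × ℕ} (hb : IsFilling h b)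
    {u : WordSpace n} (hu : u ∈ wordModule b) :
    isotypicProj (GroupAlg n) (WordSpace n) (fillingModule b) u ∈ fillingModule b := by
  have := hb.isSimpleModule
  refine OneSided.isotypicProj_mem (wordModule b) _ (le_isotypicComponent _) (fun θ hθ x => ?_) hu
  obtain ⟨z, hz⟩ := hb.exists_eq_smul θ (hθ _)
  rw [hz]
  exact complex_smul_mem _ z x.2

/-- The antisymmetrizer of a filling kills a word vector killed by the isotypic projection. -/
theorem IsFilling.antisymmetrizer_smul_eq_zero {n : ℕ} {h : ℕ → ℕ} {b : Fin n → ℕ × ℕ}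
    (hb : IsFilling h b) {u : WordSpace n} (hu : u ∈ wordModule b)
    (h0 : isotypicProj (GroupAlg n) (WordSpace n) (fillingModule b) u = 0) :
    antisymmetrizer b • u = 0 := by
  obtain ⟨z, hz⟩ := hb.exists_smul_fillingVector hu
  have h1 := isotypicProj_apply_of_mem (fillingModule b)
    (complex_smul_mem _ z (fillingVector_mem b))
  rw [← hz, map_smul, h0, smul_zero] at h1
  exact h1.symm

/-- A vector of the module of a filling killed by all conjugate antisymmetrizers is zero. -/
theorem IsFilling.eq_zero_of_antisymmetrizer {n : ℕ} {h : ℕ → ℕ} {b : Fin n → ℕ × ℕ}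
    (hb : IsFilling h b) {v : WordSpace n} (hv : v ∈ fillingModule b)
    (h0 : ∀ σ : Sym n, antisymmetrizer (b ∘ σ) • v = 0) : v = 0 := by
  by_contra hne
  have := hb.isSimpleModule
  have hspan : fillingVector b ∈ Submodule.span (GroupAlg n) {v} := by
    have h1 := IsSimpleModule.span_singleton_eq_top (R := GroupAlg n) (M := fillingModule b)
      (m := ⟨v, hv⟩) (fun h => hne (congrArg Subtype.val h))
    have h2 : (⟨fillingVector b, fillingVector_mem b⟩ : fillingModule b) ∈
        Submodule.span (GroupAlg n) {(⟨v, hv⟩ : fillingModule b)} := by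
      rw [h1]; exact Submodule.mem_top
    obtain ⟨a, ha⟩ := Submodule.mem_span_singleton.mp h2
    exact Submodule.mem_span_singleton.mpr ⟨a, congrArg Subtype.val ha⟩
  have hker : fillingVector b ∈ LinearMap.ker
      (Algebra.lsmul ℂ ℂ (WordSpace n) (antisymmetrizer b)) := by
    refine span_singleton_induction _ (fun σ => ?_) hspan
    have h1 := h0 σ
    rw [antisymmetrizer_comp] at h1
    have h2 := congrArg (wordRep n σ) h1
    rw [← wordRep_mul_apply, mul_inv_cancel, map_one, map_zero] at h2
    exact h2
  obtain ⟨y, hy, hyy⟩ := exists_antisymmetrizer_smul_smul b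
  have h1 : antisymmetrizer b • fillingVector b = 0 := hker
  rw [fillingVector, hyy] at h1
  exact fillingVector_ne_zero hb.injective ((smul_eq_zero.mp h1).resolve_left hy)

/-! ### The action of the sum of all transpositions -/

theorem sum_swap_conj {n : ℕ} (σ : Sym n) (v : WordSpace n) :
    ∑ i : Fin n, ∑ j : Fin n, wordRep n (Equiv.swap i j) (wordRep n σ v) =
      wordRep n σ (∑ i : Fin n, ∑ j : Fin n, wordRep n (Equiv.swap i j) v) := by
  simp only [map_sum]
  rw [← Equiv.sum_comp σ]
  refine Finset.sum_congr rfl fun i _ => ?_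
  rw [← Equiv.sum_comp σ]
  refine Finset.sum_congr rfl fun j _ => ?_
  rw [← wordRep_mul_apply, ← wordRep_mul_apply, Equiv.mul_swap_eq_swap_mul]

theorem IsFilling.antisymmetrizer_smul_swap {n : ℕ} {h : ℕ → ℕ} {b : Fin n → ℕ × ℕ}
    (hb : IsFilling h b) (i j : Fin n) :
    antisymmetrizer b • wordRep n (Equiv.swap i j) (ofWord (rowWord b)) =
      (((if (b i).1 = (b j).1 then 1 else 0) - (if (b i).2 = (b j).2 then 1 else 0) +
        (if i = j then 1 else 0) : ℤ) : ℂ) • fillingVector b := by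
  rcases eq_or_ne i j with rfl | hij
  · rw [Equiv.swap_self, show Equiv.refl (Fin n) = (1 : Sym n) from rfl, map_one]
    simp [fillingVector]
  rw [if_neg hij]
  by_cases hc : (b i).2 = (b j).2
  · have hr : (b i).1 ≠ (b j).1 := fun hr => hij (hb.injective (Prod.ext hr hc))
    rw [antisymmetrizer_smul_wordRep b (swap_mem_columnStabilizer hc), if_neg hr, if_pos hc,
      Equiv.Perm.sign_swap hij]
    simp [fillingVector]
  rw [wordRep_ofWord, Equiv.swap_inv, if_neg hc]
  by_cases hr : (b i).1 = (b j).1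
  · rw [comp_swap_eq_self (w := rowWord b) hr, if_pos hr]
    simp [fillingVector]
  rw [if_neg hr]
  have key : ∀ i j : Fin n, (b i).2 ≠ (b j).2 → (b i).1 < (b j).1 →
      antisymmetrizer b • ofWord (rowWord b ∘ Equiv.swap i j) = 0 := by
    intro i j hc hlt
    obtain ⟨p, hp⟩ := (hb.exists_iff (b i).1 (b j).2).mpr
      (hlt.trans ((hb.exists_iff _ _).mp ⟨j, rfl⟩))
    have hpj : p ≠ j := by
      rintro rfl
      rw [hp] at hlt
      exact lt_irrefl _ hlt
    have hpi : p ≠ i := by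
      rintro rfl
      exact hc (by rw [hp])
    refine antisymmetrizer_smul_ofWord_eq_zero hpj (by rw [hp]) ?_
    rw [Function.comp_apply, Function.comp_apply, Equiv.swap_apply_of_ne_of_ne hpi hpj,
      Equiv.swap_apply_right, rowWord, hp]
    rfl
  have : antisymmetrizer b • ofWord (rowWord b ∘ Equiv.swap i j) = 0 := by
    rcases lt_or_gt_of_ne hr with hlt | hlt
    · exact key i j hc hlt
    · rw [Equiv.swap_comm]
      exact key j i (Ne.symm hc) hlt
  rw [this]
  simp

/-- The sum of all transpositions acts as a scalar on the module of a filling. -/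
theorem IsFilling.sum_swap_eq {n : ℕ} {h : ℕ → ℕ} {b : Fin n → ℕ × ℕ} (hb : IsFilling h b)
    {v : WordSpace n} (hv : v ∈ fillingModule b) :
    ∑ i : Fin n, ∑ j : Fin n, wordRep n (Equiv.swap i j) v =
      ((∑ i : Fin n, ∑ j : Fin n, ((if (b i).1 = (b j).1 then 1 else 0) -
        (if (b i).2 = (b j).2 then 1 else 0) + (if i = j then 1 else 0)) : ℤ) : ℂ) • v := by
  set z : ℂ := ((∑ i : Fin n, ∑ j : Fin n, ((if (b i).1 = (b j).1 then 1 else 0) -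
        (if (b i).2 = (b j).2 then 1 else 0) + (if i = j then 1 else 0)) : ℤ) : ℂ) with hz
  set Z : WordSpace n →ₗ[ℂ] WordSpace n :=
    ∑ i : Fin n, ∑ j : Fin n, wordRep n (Equiv.swap i j) with hZ
  have hZv : ∀ v, Z v = ∑ i : Fin n, ∑ j : Fin n, wordRep n (Equiv.swap i j) v := by
    intro v
    simp [hZ, LinearMap.sum_apply]
  have hcomm : ∀ (σ : Sym n) (v : WordSpace n), Z (wordRep n σ v) = wordRep n σ (Z v) := by
    intro σ v
    rw [hZv, hZv, sum_swap_conj]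
  have hs : Z (fillingVector b) = z • fillingVector b := by
    have h1 : Z (fillingVector b) = antisymmetrizer b • Z (ofWord (rowWord b)) := by
      classical
      rw [fillingVector, antisymmetrizer_smul, antisymmetrizer_smul, map_sum]
      refine Finset.sum_congr rfl fun σ _ => ?_
      split_ifs
      · rw [map_smul, hcomm]
      · rw [map_zero]
    rw [h1, hZv, Finset.smul_sum, hz, Int.cast_sum, Finset.sum_smul]
    refine Finset.sum_congr rfl fun i _ => ?_
    rw [Finset.smul_sum, Int.cast_sum, Finset.sum_smul]
    exact Finset.sum_congr rfl fun j _ => hb.antisymmetrizer_smul_swap i j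
  rw [← hZv]
  have hker : v ∈ LinearMap.ker (Z - z • LinearMap.id) := by
    refine span_singleton_induction _ (fun σ => ?_) hv
    rw [LinearMap.mem_ker, LinearMap.sub_apply, hcomm, hs]
    simp
  rw [LinearMap.mem_ker, LinearMap.sub_apply] at hker
  simpa [sub_eq_zero] using hker

/-! ### Adding a symbol -/

/-- The extension of a permutation that fixes the last position. -/
def extendPerm {n : ℕ} (σ : Sym n) : Sym (n + 1) :=
  finSuccEquivLast.symm.permCongr (Equiv.optionCongr σ)

@[simp]
theorem extendPerm_castSucc {n : ℕ} (σ : Sym n) (p : Fin n) :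
    extendPerm σ p.castSucc = (σ p).castSucc := by
  simp [extendPerm, Equiv.permCongr_apply]

@[simp]
theorem extendPerm_last {n : ℕ} (σ : Sym n) : extendPerm σ (Fin.last n) = Fin.last n := by
  simp [extendPerm, Equiv.permCongr_apply]

theorem sign_extendPerm {n : ℕ} (σ : Sym n) :
    Equiv.Perm.sign (extendPerm σ) = Equiv.Perm.sign σ := by
  rw [extendPerm, Equiv.Perm.sign_permCongr, Equiv.optionCongr_sign]

theorem extendPerm_injective {n : ℕ} : Function.Injective (extendPerm : Sym n → Sym (n + 1)) :=
  (Equiv.injective _).comp Equiv.optionCongr_injective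

theorem extendPerm_inv {n : ℕ} (σ : Sym n) : (extendPerm σ)⁻¹ = extendPerm σ⁻¹ := by
  rw [inv_eq_iff_mul_eq_one]
  ext p
  induction p using Fin.lastCases <;> simp

theorem extendPerm_swap {n : ℕ} (i j : Fin n) :
    extendPerm (Equiv.swap i j) = Equiv.swap i.castSucc j.castSucc := by
  ext1 p
  induction p using Fin.lastCases with
  | last =>
    rw [extendPerm_last, Equiv.swap_apply_of_ne_of_ne (Fin.castSucc_lt_last i).ne'
      (Fin.castSucc_lt_last j).ne']
  | cast p =>
    rw [extendPerm_castSucc, Equiv.swap_apply_def, Equiv.swap_apply_def]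
    simp only [Fin.castSucc_inj]
    split_ifs <;> rfl

theorem exists_extendPerm {n : ℕ} {σ : Sym (n + 1)} (h : σ (Fin.last n) = Fin.last n) :
    ∃ τ : Sym n, extendPerm τ = σ := by
  have h1 : ∀ p : Fin n, ∃ q : Fin n, q.castSucc = σ p.castSucc := fun p => by
    refine Fin.exists_castSucc_eq.mpr fun hp => ?_
    exact (Fin.castSucc_lt_last p).ne (σ.injective (hp.trans h.symm))
  choose f hf using h1
  have hinj : Function.Injective f := fun p q hpq => by
    have := hf p
    rw [hpq, hf q] at this
    exact Fin.castSucc_injective n (σ.injective this.symm)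
  refine ⟨Equiv.ofBijective f (Finite.injective_iff_bijective.mp hinj), ?_⟩
  ext1 p
  induction p using Fin.lastCases with
  | last => rw [extendPerm_last, h]
  | cast p => rw [extendPerm_castSucc, ← hf]; rfl

theorem adding_ofWord {n : ℕ} (a : ℕ) (w : Word n) :
    adding n a (ofWord w) = ofWord (Fin.snoc w a : Word (n + 1)) := by
  simp [adding, ofWord, Finsupp.mapDomain_single]

theorem snoc_comp_extendPerm {n : ℕ} (w : Word n) (a : ℕ) (σ : Sym n) :
    (Fin.snoc w a : Word (n + 1)) ∘ extendPerm σ = (Fin.snoc (w ∘ σ) a : Word (n + 1)) := by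
  ext p
  induction p using Fin.lastCases <;> simp

theorem wordRep_adding {n : ℕ} (a : ℕ) (σ : Sym n) (v : WordSpace n) :
    wordRep (n + 1) (extendPerm σ) (adding n a v) = adding n a (wordRep n σ v) := by
  have : wordRep (n + 1) (extendPerm σ) ∘ₗ adding n a = adding n a ∘ₗ wordRep n σ := by
    refine Finsupp.lhom_ext' fun w => LinearMap.ext_ring ?_
    change wordRep (n + 1) (extendPerm σ) (adding n a (ofWord w)) =
      adding n a (wordRep n σ (ofWord w))
    rw [adding_ofWord, wordRep_ofWord, wordRep_ofWord, adding_ofWord, extendPerm_inv,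
      snoc_comp_extendPerm]
  exact LinearMap.congr_fun this v

theorem snoc_word_injective (n a : ℕ) :
    Function.Injective (fun w : Word n => (Fin.snoc w a : Word (n + 1))) := fun w w' h => by
  ext p
  simpa using congrFun h p.castSucc

theorem adding_apply_snoc {n : ℕ} (a : ℕ) (v : WordSpace n) (w : Word n) :
    adding n a v (Fin.snoc w a : Word (n + 1)) = v w :=
  Finsupp.mapDomain_apply (snoc_word_injective n a) v w

theorem adding_apply_of_ne {n : ℕ} {a : ℕ} (v : WordSpace n) {w : Word (n + 1)}
    (h : w (Fin.last n) ≠ a) : adding n a v w = 0 := by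
  refine Finsupp.mapDomain_of_notMem_range v w ?_
  rintro ⟨w', rfl⟩
  exact h (by simp)

theorem rowWord_eq_snoc {n : ℕ} (b : Fin (n + 1) → ℕ × ℕ) :
    rowWord b = (Fin.snoc (rowWord (b ∘ Fin.castSucc)) (b (Fin.last n)).1 : Word (n + 1)) := by
  ext p
  induction p using Fin.lastCases <;> simp [rowWord]

theorem extendPerm_mem_columnStabilizer {n : ℕ} {b : Fin (n + 1) → ℕ × ℕ} {σ : Sym n} :
    extendPerm σ ∈ columnStabilizer b ↔ σ ∈ columnStabilizer (b ∘ Fin.castSucc) := by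
  rw [mem_columnStabilizer, mem_columnStabilizer, Fin.forall_fin_succ']
  simp

theorem antisymmetrizer_smul_adding_apply {n : ℕ} {b : Fin (n + 1) → ℕ × ℕ}
    (hb : Function.Injective b) (v : WordSpace n) :
    (antisymmetrizer b • adding n (b (Fin.last n)).1 v) (rowWord b) =
      (antisymmetrizer (b ∘ Fin.castSucc) • v) (rowWord (b ∘ Fin.castSucc)) := by
  classical
  rw [antisymmetrizer_smul_apply, antisymmetrizer_smul_apply]
  symm
  refine Finset.sum_of_injOn extendPerm extendPerm_injective.injOn (by simp) ?_ ?_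
  · intro σ _ hσ
    split_ifs with h
    · rw [adding_apply_of_ne, mul_zero]
      intro he
      obtain ⟨τ, rfl⟩ := exists_extendPerm (hb (Prod.ext he (h (Fin.last n))))
      exact hσ ⟨τ, by simp, rfl⟩
    · rfl
  · intro σ _
    simp only [extendPerm_mem_columnStabilizer, sign_extendPerm]
    split_ifs
    · conv_rhs => rw [rowWord_eq_snoc, snoc_comp_extendPerm, adding_apply_snoc]
    · rfl

theorem adding_mem_wordModule {n : ℕ} (b : Fin (n + 1) → ℕ × ℕ) {v : WordSpace n}
    (hv : v ∈ wordModule (b ∘ Fin.castSucc)) :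
    adding n (b (Fin.last n)).1 v ∈ wordModule b := by
  have : v ∈ ((wordModule b).restrictScalars ℂ).comap (adding n (b (Fin.last n)).1) := by
    refine span_singleton_induction _ (fun σ => ?_) hv
    change adding n (b (Fin.last n)).1 _ ∈ wordModule b
    rw [← wordRep_adding, adding_ofWord, ← rowWord_eq_snoc]
    exact wordRep_mem _ _ (ofWord_rowWord_mem b)
  exact this

theorem IsFilling.antisymmetrizer_smul_eq_zero_of_adding {n : ℕ} {h h' : ℕ → ℕ}
    {b : Fin (n + 1) → ℕ × ℕ} (hb : IsFilling h b) (hb' : IsFilling h' (b ∘ Fin.castSucc))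
    {v : WordSpace n} (hv : v ∈ wordModule (b ∘ Fin.castSucc))
    (h0 : antisymmetrizer b • adding n (b (Fin.last n)).1 v = 0) :
    antisymmetrizer (b ∘ Fin.castSucc) • v = 0 := by
  obtain ⟨z, hz⟩ := hb'.exists_smul_fillingVector hv
  have h1 := antisymmetrizer_smul_adding_apply hb.injective v
  rw [h0, hz, Finsupp.smul_apply, fillingVector_apply_rowWord hb'.injective] at h1
  have hz0 : z = 0 := by simpa using h1.symm
  rw [hz, hz0, zero_smul]

/-- Adding a box and projecting to the isotypic component does not kill any nonzero vector. -/
theorem IsFilling.isotypicProj_adding_ne_zero {n : ℕ} {h h' : ℕ → ℕ}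
    {b : Fin (n + 1) → ℕ × ℕ} (hb : IsFilling h b) (hb' : IsFilling h' (b ∘ Fin.castSucc))
    {v : WordSpace n} (hv : v ∈ fillingModule (b ∘ Fin.castSucc)) (hne : v ≠ 0) :
    isotypicProj (GroupAlg (n + 1)) (WordSpace (n + 1)) (fillingModule b)
      (adding n (b (Fin.last n)).1 v) ≠ 0 := by
  intro h0
  refine hne (hb'.eq_zero_of_antisymmetrizer hv fun σ => ?_)
  have hvw := fillingModule_le_wordModule _ hv
  have hcomp : (b ∘ extendPerm σ) ∘ Fin.castSucc = (b ∘ Fin.castSucc) ∘ σ := by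
    ext1 p; simp
  have hlast : (b ∘ extendPerm σ) (Fin.last n) = b (Fin.last n) := by simp
  rw [← hcomp]
  refine (hb.comp (extendPerm σ)).antisymmetrizer_smul_eq_zero_of_adding ?_ ?_ ?_ (h' := h')
  · rw [hcomp]; exact hb'.comp σ
  · rw [hcomp, wordModule_comp]; exact hvw
  · rw [hlast]
    refine (hb.comp (extendPerm σ)).antisymmetrizer_smul_eq_zero ?_ ?_
    · rw [wordModule_comp]; exact adding_mem_wordModule b hvw
    · rw [fillingModule_comp]; exact h0

/-! ### Jucys–Murphy elements -/

/-- The action of a Jucys–Murphy element: the sum of the transpositions of position `j` with the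
earlier positions. -/
def jucysMurphy (n : ℕ) (j : Fin n) : Module.End ℂ (WordSpace n) :=
  ∑ i ∈ Finset.Iio j, wordRep n (Equiv.swap i j)

/-- The number of earlier entries in the same row minus the number of earlier entries in the same
column. -/
def content {n : ℕ} (b : Fin n → ℕ × ℕ) (j : Fin n) : ℤ :=
  ∑ i ∈ Finset.Iio j, ((if (b i).1 = (b j).1 then 1 else 0) - (if (b i).2 = (b j).2 then 1 else 0))

theorem sum_sum_eq_of_symm {n : ℕ} {G : Type*} [AddCommGroup G] (F : Fin n → Fin n → G)
    (hF : ∀ i j, F i j = F j i) :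
    ∑ i, ∑ j, F i j = 2 • ∑ j, ∑ i ∈ Finset.Iio j, F i j + ∑ i, F i i := by
  have h1 : ∀ i, ∑ j, F i j = ∑ j ∈ Finset.Iio i, F i j + F i i + ∑ j ∈ Finset.Ioi i, F i j := by
    intro i
    have hu : (Finset.univ : Finset (Fin n)) = (Finset.Iio i ∪ {i}) ∪ Finset.Ioi i := by
      ext j
      simp only [Finset.mem_univ, Finset.mem_union, Finset.mem_Iio, Finset.mem_singleton,
        Finset.mem_Ioi, true_iff]
      rcases lt_trichotomy j i with h | h | h <;> simp [h]
    rw [hu, Finset.sum_union, Finset.sum_union, Finset.sum_singleton]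
    · simp
    · rw [Finset.disjoint_left]
      intro j hj hj'
      simp only [Finset.mem_union, Finset.mem_Iio, Finset.mem_singleton, Finset.mem_Ioi] at hj hj'
      rcases hj with h | h
      · exact lt_asymm h hj'
      · exact hj'.ne' h
  have h2 : ∑ i, ∑ j ∈ Finset.Ioi i, F i j = ∑ j, ∑ i ∈ Finset.Iio j, F i j :=
    Finset.sum_comm' (by simp)
  have h3 : ∑ i, ∑ j ∈ Finset.Iio i, F i j = ∑ j, ∑ i ∈ Finset.Iio j, F i j :=
    Finset.sum_congr rfl fun i _ => Finset.sum_congr rfl fun j _ => hF i j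
  rw [Finset.sum_congr rfl fun i _ => h1 i, Finset.sum_add_distrib, Finset.sum_add_distrib, h2, h3,
    two_smul]
  abel

theorem IsFilling.sum_jucysMurphy {n : ℕ} {h : ℕ → ℕ} {b : Fin n → ℕ × ℕ} (hb : IsFilling h b)
    {v : WordSpace n} (hv : v ∈ fillingModule b) :
    ∑ j, jucysMurphy n j v = ((∑ j, content b j : ℤ) : ℂ) • v := by
  have h1 := hb.sum_swap_eq hv
  rw [sum_sum_eq_of_symm (fun i j => wordRep n (Equiv.swap i j) v)
      (fun i j => by rw [Equiv.swap_comm]),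
    sum_sum_eq_of_symm (fun i j : Fin n => ((if (b i).1 = (b j).1 then (1 : ℤ) else 0) -
        (if (b i).2 = (b j).2 then 1 else 0) + (if i = j then 1 else 0)))
      (fun i j => by simp only [eq_comm])] at h1
  have h2 : ∀ j : Fin n, ∑ i ∈ Finset.Iio j, ((if (b i).1 = (b j).1 then (1 : ℤ) else 0) -
        (if (b i).2 = (b j).2 then 1 else 0) + (if i = j then 1 else 0)) = content b j := by
    intro j
    refine Finset.sum_congr rfl fun i hi => ?_
    rw [if_neg (Finset.mem_Iio.mp hi).ne, add_zero]
  have h3 : ∀ j : Fin n, ∑ i ∈ Finset.Iio j, wordRep n (Equiv.swap i j) v =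
      jucysMurphy n j v := fun j => by rw [jucysMurphy, LinearMap.sum_apply]
  have h4 : ∀ i : Fin n, wordRep n (Equiv.swap i i) v = v := fun i => by
    rw [Equiv.swap_self, show Equiv.refl (Fin n) = (1 : Sym n) from rfl, map_one]
    rfl
  simp only [h2, h3, h4] at h1
  simp only [if_true, sub_self, zero_add, Finset.sum_const, Finset.card_univ, Fintype.card_fin,
    nsmul_eq_mul, mul_one] at h1
  rw [Int.cast_add, add_smul, Int.cast_natCast, Nat.cast_smul_eq_nsmul, add_left_inj, Int.cast_mul,
    mul_smul] at h1
  have h5 := congrArg ((2 : ℂ)⁻¹ • ·) h1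
  simp only [← Nat.cast_smul_eq_nsmul ℂ] at h5
  simpa using h5

theorem jucysMurphy_castSucc {n : ℕ} (j : Fin n) (v : WordSpace (n + 1)) :
    jucysMurphy (n + 1) j.castSucc v =
      ∑ i ∈ Finset.Iio j, wordRep (n + 1) (extendPerm (Equiv.swap i j)) v := by
  rw [jucysMurphy, LinearMap.sum_apply]
  have : Finset.Iio j.castSucc = (Finset.Iio j).map Fin.castSuccEmb := by
    ext i
    induction i using Fin.lastCases <;> simp
  rw [this, Finset.sum_map]
  refine Finset.sum_congr rfl fun i _ => ?_
  rw [extendPerm_swap]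
  rfl

theorem content_castSucc {n : ℕ} (b : Fin (n + 1) → ℕ × ℕ) (j : Fin n) :
    content b j.castSucc = content (b ∘ Fin.castSucc) j := by
  rw [content, content]
  have : Finset.Iio j.castSucc = (Finset.Iio j).map Fin.castSuccEmb := by
    ext i
    induction i using Fin.lastCases <;> simp
  rw [this, Finset.sum_map]
  rfl

/-- Lifting preserves joint eigenvectors of the Jucys–Murphy elements with contents as
eigenvalues. -/
theorem IsFilling.jucysMurphy_isotypicProj_adding {n : ℕ} {h : ℕ → ℕ}
    {b : Fin (n + 1) → ℕ × ℕ} (hb : IsFilling h b)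
    {v : WordSpace n} (hv : v ∈ fillingModule (b ∘ Fin.castSucc))
    (hJ : ∀ j, jucysMurphy n j v = (content (b ∘ Fin.castSucc) j : ℂ) • v) (j : Fin (n + 1)) :
    jucysMurphy (n + 1) j (isotypicProj (GroupAlg (n + 1)) (WordSpace (n + 1)) (fillingModule b)
      (adding n (b (Fin.last n)).1 v)) =
      (content b j : ℂ) • isotypicProj (GroupAlg (n + 1)) (WordSpace (n + 1)) (fillingModule b)
        (adding n (b (Fin.last n)).1 v) := by
  set f := isotypicProj (GroupAlg (n + 1)) (WordSpace (n + 1)) (fillingModule b)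
  set u := f (adding n (b (Fin.last n)).1 v) with hu
  have hmem : u ∈ fillingModule b :=
    hb.isotypicProj_mem (adding_mem_wordModule b (fillingModule_le_wordModule _ hv))
  have hcast : ∀ j : Fin n, jucysMurphy (n + 1) j.castSucc u = (content b j.castSucc : ℂ) • u := by
    intro j
    have h1 : ∀ σ : Sym n, wordRep (n + 1) (extendPerm σ) u =
        f (adding n (b (Fin.last n)).1 (wordRep n σ v)) := fun σ => by
      rw [hu, ← single_one_smul, ← map_smul, single_one_smul, wordRep_adding]
    rw [jucysMurphy_castSucc, content_castSucc]
    simp only [h1]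
    rw [← map_sum, ← map_sum]
    have h2 := hJ j
    rw [jucysMurphy, LinearMap.sum_apply] at h2
    rw [h2, map_smul, hu, ← one_smul (GroupAlg (n + 1)) (adding n _ v), ← smul_assoc, map_smul,
      smul_assoc, one_smul, one_smul]
  induction j using Fin.lastCases with
  | cast j => exact hcast j
  | last =>
    have h1 := hb.sum_jucysMurphy hmem
    rw [Fin.sum_univ_castSucc, Fin.sum_univ_castSucc, Finset.sum_congr rfl fun j _ => hcast j,
      ← Finset.sum_smul, Int.cast_add, Int.cast_sum, add_smul] at h1
    exact add_left_cancel h1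

/-! ### Tableaux as fillings -/

namespace StandardTableau

variable {n : ℕ} {lam : YoungDiagram}

/-- The boxes of a tableau in the order of their labels. -/
def filling (T : StandardTableau n lam) : Fin n → ℕ × ℕ := fun p => (T.box p).1

theorem isFilling (T : StandardTableau n lam) : IsFilling lam.colLen T.filling where
  injective := Subtype.val_injective.comp T.box.injective
  exists_iff i j := by
    rw [← YoungDiagram.mem_iff_lt_colLen]
    constructor
    · rintro ⟨p, hp⟩
      rw [← hp]
      exact (T.box p).2
    · intro h
      exact ⟨T.box.symm ⟨(i, j), h⟩, by simp [filling]⟩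

theorem polytabloid_eq (T : StandardTableau n lam) : T.polytabloid = fillingVector T.filling := by
  classical
  rw [fillingVector, antisymmetrizer_smul, polytabloid, ← Finset.sum_filter]
  refine Finset.sum_congr ?_ fun σ _ => ?_
  · ext σ
    simp [colStab, mem_columnStabilizer, filling]
  · rw [wordRep_ofWord]
    rfl

theorem specht_eq (T : StandardTableau n lam) : specht n lam = fillingModule T.filling := by
  apply le_antisymm
  · rw [specht, Submodule.span_le]
    rintro _ ⟨T', rfl⟩
    obtain ⟨σ, hσ⟩ := T.isFilling.exists_comp_eq T'.isFilling
    rw [polytabloid_eq, ← fillingModule_comp T.filling σ, ← hσ]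
    exact fillingVector_mem _
  · rw [fillingModule, Submodule.span_singleton_le_iff_mem, ← polytabloid_eq]
    exact Submodule.subset_span ⟨T, rfl⟩

theorem mem_shapeAt (T : StandardTableau n lam) {m : ℕ} {c : ℕ × ℕ} :
    c ∈ (T.shapeAt m).cells ↔ ∃ p : Fin n, (p : ℕ) < m ∧ (T.box p).1 = c := by
  simp [shapeAt]

/-- The tableau formed by the boxes with the smallest labels. -/
def truncate (T : StandardTableau n lam) (m : ℕ) (h : m ≤ n) : StandardTableau m (T.shapeAt m) :=
  let e : Fin m ≃ (T.shapeAt m).cells := Equiv.ofBijective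
    (fun p => ⟨(T.box (p.castLE h)).1, T.mem_shapeAt.mpr ⟨p.castLE h, p.2, rfl⟩⟩)
    ⟨fun p q hpq => Fin.castLE_injective h
        (T.box.injective (Subtype.ext (Subtype.mk.inj hpq))),
      fun c => by
        obtain ⟨p, hp, hc⟩ := T.mem_shapeAt.mp c.2
        exact ⟨⟨p, hp⟩, Subtype.ext hc⟩⟩
  have he : ∀ p, ((e p).1 : ℕ × ℕ) = (T.box (p.castLE h)).1 := fun _ => rfl
  { box := e
    row_lt := fun c d hr hc => by
      obtain ⟨p, rfl⟩ := e.surjective c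
      obtain ⟨q, rfl⟩ := e.surjective d
      rw [Equiv.symm_apply_apply, Equiv.symm_apply_apply]
      simpa using T.row_lt (T.box (p.castLE h)) (T.box (q.castLE h)) hr hc
    col_lt := fun c d hc hr => by
      obtain ⟨p, rfl⟩ := e.surjective c
      obtain ⟨q, rfl⟩ := e.surjective d
      rw [Equiv.symm_apply_apply, Equiv.symm_apply_apply]
      simpa using T.col_lt (T.box (p.castLE h)) (T.box (q.castLE h)) hc hr }

theorem truncate_filling_succ (T : StandardTableau n lam) (m : ℕ) (h : m + 1 ≤ n) :
    (T.truncate (m + 1) h).filling ∘ Fin.castSucc =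
      (T.truncate m (Nat.le_of_succ_le h)).filling := rfl

theorem content_filling (T : StandardTableau n lam) (p : Fin n) :
    content T.filling p = ((T.box p).1.2 : ℤ) - ((T.box p).1.1 : ℤ) := by
  rw [content, Finset.sum_sub_distrib, Finset.sum_boole, Finset.sum_boole]
  have hlt : ∀ q, T.filling q ≤ T.filling p → T.filling q ≠ T.filling p → q < p := by
    intro q hle hne
    have := T.symm_le (T.box q) (T.box p) hle
    rw [Equiv.symm_apply_apply, Equiv.symm_apply_apply] at this
    exact lt_of_le_of_ne this fun h => hne (by rw [h])
  have hge : ∀ q, q < p → ¬ T.filling p ≤ T.filling q := by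
    intro q hq hle
    have := T.symm_le (T.box p) (T.box q) hle
    rw [Equiv.symm_apply_apply, Equiv.symm_apply_apply] at this
    exact absurd hq this.not_gt
  have hfil : ∀ c ≤ T.filling p, ∃ q, T.filling q = c := by
    intro c hc
    have hmem : c ∈ lam.cells := lam.isLowerSet hc (T.box p).2
    exact ⟨T.box.symm ⟨c, hmem⟩, by simp [filling]⟩
  have hrow : ((Finset.Iio p).filter fun i => (T.filling i).1 = (T.filling p).1).card =
      (T.filling p).2 := by
    rw [← Finset.card_range (T.filling p).2]
    refine Finset.card_bij (fun q _ => (T.filling q).2) ?_ ?_ ?_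
    · intro q hq
      rw [Finset.mem_filter, Finset.mem_Iio] at hq
      rw [Finset.mem_range]
      by_contra hcon
      exact hge q hq.1 ⟨hq.2.ge, not_lt.mp hcon⟩
    · intro q hq q' hq' hqq
      rw [Finset.mem_filter] at hq hq'
      exact T.isFilling.injective (Prod.ext (hq.2.trans hq'.2.symm) hqq)
    · intro k hk
      rw [Finset.mem_range] at hk
      obtain ⟨q, hq⟩ := hfil ((T.filling p).1, k) ⟨le_rfl, hk.le⟩
      refine ⟨q, ?_, by rw [hq]⟩
      rw [Finset.mem_filter, Finset.mem_Iio]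
      refine ⟨hlt q (by rw [hq]; exact ⟨le_rfl, hk.le⟩) fun h => ?_, by rw [hq]⟩
      rw [← h, hq] at hk
      exact lt_irrefl _ hk
  have hcol : ((Finset.Iio p).filter fun i => (T.filling i).2 = (T.filling p).2).card =
      (T.filling p).1 := by
    rw [← Finset.card_range (T.filling p).1]
    refine Finset.card_bij (fun q _ => (T.filling q).1) ?_ ?_ ?_
    · intro q hq
      rw [Finset.mem_filter, Finset.mem_Iio] at hq
      rw [Finset.mem_range]
      by_contra hcon
      exact hge q hq.1 ⟨not_lt.mp hcon, hq.2.ge⟩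
    · intro q hq q' hq' hqq
      rw [Finset.mem_filter] at hq hq'
      exact T.isFilling.injective (Prod.ext hqq (hq.2.trans hq'.2.symm))
    · intro k hk
      rw [Finset.mem_range] at hk
      obtain ⟨q, hq⟩ := hfil (k, (T.filling p).2) ⟨hk.le, le_rfl⟩
      refine ⟨q, ?_, by rw [hq]⟩
      rw [Finset.mem_filter, Finset.mem_Iio]
      refine ⟨hlt q (by rw [hq]; exact ⟨hk.le, le_rfl⟩) fun h => ?_, by rw [hq]⟩
      rw [← h, hq] at hk
      exact lt_irrefl _ hk
  rw [hrow, hcol]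
  rfl

/-- The lifted vectors are joint eigenvectors of the Jucys–Murphy elements in the Specht
modules. -/
theorem liftedUpTo_spec (T : StandardTableau n lam) : ∀ (m : ℕ) (h : m ≤ n),
    T.liftedUpTo m h ∈ fillingModule (T.truncate m h).filling ∧ T.liftedUpTo m h ≠ 0 ∧
      ∀ j, jucysMurphy m j (T.liftedUpTo m h) =
        (content (T.truncate m h).filling j : ℂ) • T.liftedUpTo m h
  | 0, h => by
    refine ⟨?_, ?_, fun j => j.elim0⟩
    · have h1 : fillingVector (T.truncate 0 h).filling = T.liftedUpTo 0 h := by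
        have : antisymmetrizer (T.truncate 0 h).filling = 1 := by
          rw [antisymmetrizer, Fintype.sum_unique, if_pos (mem_columnStabilizer.mpr fun p => p.elim0)]
          rw [Subsingleton.elim (default : Sym 0) 1, Equiv.Perm.sign_one]
          simp [MonoidAlgebra.one_def]
        rw [fillingVector, this, one_smul, liftedUpTo]
        congr 1
        exact Subsingleton.elim _ _
      rw [← h1]
      exact fillingVector_mem _
    · rw [liftedUpTo, ofWord]
      simp
  | m + 1, h => by
    obtain ⟨hmem, hne, hJ⟩ := T.liftedUpTo_spec m (Nat.le_of_succ_le h)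
    have hb := (T.truncate (m + 1) h).isFilling
    have hb' := (T.truncate m (Nat.le_of_succ_le h)).isFilling
    rw [← truncate_filling_succ T m h] at hmem hJ hb'
    have heq : T.liftedUpTo (m + 1) h =
        isotypicProj (GroupAlg (m + 1)) (WordSpace (m + 1))
          (fillingModule (T.truncate (m + 1) h).filling)
          (adding m ((T.truncate (m + 1) h).filling (Fin.last m)).1
            (T.liftedUpTo m (Nat.le_of_succ_le h))) := by
      rw [← specht_eq]
      rfl
    rw [heq]
    exact ⟨hb.isotypicProj_mem (adding_mem_wordModule _ (fillingModule_le_wordModule _ hmem)),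
      hb.isotypicProj_adding_ne_zero hb' hmem hne,
      hb.jucysMurphy_isotypicProj_adding hmem hJ⟩

theorem truncate_self_filling (T : StandardTableau n lam) :
    (T.truncate n le_rfl).filling = T.filling := rfl

end StandardTableau

/-! ### The shuffle -/

theorem sum_shuffleProb_smul {n : ℕ} {V : Type*} [AddCommGroup V] [Module ℂ V] (F : Sym n → V) :
    ∑ τ, ((shuffleProb n τ : ℝ) : ℂ) • F τ =
      ∑ j : Fin n, (1 / ((n : ℂ) * ((j : ℕ) + 1 : ℂ))) •
        (∑ i ∈ Finset.Iio j, F (Equiv.swap i j) + F 1) := by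
  simp only [shuffleProb, Complex.ofReal_sum, Finset.sum_smul]
  rw [Finset.sum_comm]
  refine Finset.sum_congr rfl fun j _ => ?_
  rw [Finset.sum_comm]
  have hI : Finset.Iic j = insert j (Finset.Iio j) := (Finset.Iio_insert j).symm
  have h1 : ∀ i : Fin n, ∑ τ, ((if Equiv.swap i j = τ then
      (1 : ℝ) / ((n : ℝ) * ((j : ℕ) + 1 : ℝ)) else 0 : ℝ) : ℂ) • F τ =
      (1 / ((n : ℂ) * ((j : ℕ) + 1 : ℂ))) • F (Equiv.swap i j) := by
    intro i
    rw [Finset.sum_eq_single (Equiv.swap i j)]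
    · simp
    · intro τ _ hτ
      simp [if_neg hτ.symm]
    · simp
  simp only [h1]
  rw [hI, Finset.sum_insert (by simp), smul_add, Finset.smul_sum, add_comm, Equiv.swap_self]
  rfl

theorem shuffleOp_apply {n : ℕ} (v : WordSpace n) :
    shuffleOp n v = ∑ τ, ((shuffleProb n τ : ℝ) : ℂ) • wordRep n τ v := by
  change shuffleElement n • v = _
  rw [shuffleElement, Finset.sum_smul]
  exact Finset.sum_congr rfl fun τ _ => single_smul τ _ v

theorem shuffleProb_inv {n : ℕ} (τ : Sym n) : shuffleProb n τ⁻¹ = shuffleProb n τ := by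
  refine Finset.sum_congr rfl fun j _ => Finset.sum_congr rfl fun i _ => ?_
  simp only [← inv_eq_iff_eq_inv, Equiv.swap_inv]

theorem StandardTableau.shuffleOp_lifted {n : ℕ} {lam : YoungDiagram}
    (T : StandardTableau n lam) :
    shuffleOp n T.lifted = ((1 / (n : ℂ)) * ∑ c : lam.cells,
        (((c.1.2 : ℂ) - (c.1.1 : ℂ) + 1) / (T.entry c : ℂ))) • T.lifted := by
  rw [shuffleOp_apply, sum_shuffleProb_smul, ← Equiv.sum_comp T.box, Finset.mul_sum,
    Finset.sum_smul]
  refine Finset.sum_congr rfl fun j _ => ?_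
  have h1 := (T.liftedUpTo_spec n le_rfl).2.2 j
  rw [truncate_self_filling, content_filling, jucysMurphy, LinearMap.sum_apply] at h1
  change _ = _ • T.lifted at h1
  change (_ : ℂ) • (∑ i ∈ Finset.Iio j, wordRep n (Equiv.swap i j) T.lifted + _) = _
  have h2 : ∑ i ∈ Finset.Iio j, wordRep n (Equiv.swap i j) T.lifted = _ := h1
  rw [h2, map_one, Module.End.one_apply, entry, Equiv.symm_apply_apply]
  nth_rewrite 2 [← one_smul ℂ T.lifted]
  rw [← add_smul, smul_smul]
  congr 1
  push_cast
  rw [one_div, one_div, mul_inv, div_eq_mul_inv]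
  ring

/-- A real eigenvalue of the shuffle on words is an eigenvalue of its transition matrix. -/
theorem hasEigenvalue_transitionMatrix {n : ℕ} {v : WordSpace n} {x : ℝ} (hv : v ≠ 0)
    (hx : shuffleOp n v = (x : ℂ) • v) :
    Module.End.HasEigenvalue (Matrix.toLin' (transitionMatrix n)) x := by
  obtain ⟨w, hw⟩ := Finsupp.ne_iff.mp hv
  rw [Finsupp.zero_apply] at hw
  set g : Sym n → ℂ := fun σ => wordRep n σ⁻¹ v w / v w with hg
  have hg1 : g 1 = 1 := by simp [hg, hw]
  have hkey : ∀ σ, ∑ τ, ((shuffleProb n τ : ℝ) : ℂ) * g (τ * σ) = x * g σ := by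
    intro σ
    have h1 := congrArg (fun u => wordRep n σ⁻¹ u w / v w) hx
    simp only [shuffleOp_apply, map_sum, map_smul, Finsupp.finsetSum_apply, Finsupp.smul_apply,
      smul_eq_mul, Finset.sum_div] at h1
    rw [← Equiv.sum_comp (Equiv.inv (Sym n))] at h1
    simp only [Equiv.inv_apply, shuffleProb_inv, ← wordRep_mul_apply, mul_div_assoc] at h1
    simpa only [hg, mul_inv_rev] using h1
  refine Module.End.hasEigenvalue_of_hasEigenvector (x := fun σ => (g σ).re)
    (Module.End.hasEigenvector_iff.mpr ⟨Module.End.mem_eigenspace_iff.mpr ?_, fun h0 => ?_⟩)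
  · ext σ
    have h1 := congrArg Complex.re (hkey σ)
    simp only [Complex.re_sum, Complex.re_ofReal_mul] at h1
    rw [Matrix.toLin'_apply, Pi.smul_apply, smul_eq_mul, ← h1, Matrix.mulVec, dotProduct,
      ← Equiv.sum_comp (Equiv.mulRight σ)]
    refine Finset.sum_congr rfl fun τ _ => ?_
    simp [transitionMatrix]
  · have := congrFun h0 1
    simp [hg1] at this

end OneSided

end

theorem lemma1p6 (n : ℕ) (hn : 1 ≤ n) (lam : YoungDiagram) (T : OneSided.StandardTableau n lam) :
    T.lifted ∈ OneSided.specht n lam ∧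
    (∀ x : ℂ, Module.End.HasEigenvector (OneSided.shuffleOp n) x T.lifted ↔
      x = (1 / (n : ℂ)) * ∑ c : lam.cells,
        (((c.1.2 : ℂ) - (c.1.1 : ℂ) + 1) / (T.entry c : ℂ))) ∧
    Module.End.HasEigenvalue (Matrix.toLin' (OneSided.transitionMatrix n))
      ((1 / (n : ℝ)) * ∑ c : lam.cells,
        (((c.1.2 : ℝ) - (c.1.1 : ℝ) + 1) / (T.entry c : ℝ))) := by
  obtain ⟨hmem, hne, -⟩ := T.liftedUpTo_spec n le_rfl
  change T.lifted ∈ _ at hmem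
  change T.lifted ≠ 0 at hne
  refine ⟨by rw [T.specht_eq]; exact hmem, fun x => ?_,
    OneSided.hasEigenvalue_transitionMatrix hne ?_⟩
  · rw [Module.End.hasEigenvector_iff, Module.End.mem_eigenspace_iff, T.shuffleOp_lifted]
    refine ⟨fun h => (smul_left_injective ℂ hne h.1).symm, fun h => ⟨by rw [h], hne⟩⟩
  · rw [T.shuffleOp_lifted]
    push_cast
    rfl
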